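/- For a finite abelian group $G$ (written additively), let the Davenport constant $\mathsf{D}(G)$ be the smallest integer $t \geq 1$ such that every finite sequence of at least $t$ elements of $G$ (repetitions allowed) contains a non-empty subsequence whose sum is $0$. For $n \geq 1$ let $C_n$ denote the cyclic group of order $n$. Then for every fixed integer $r \geq 1$, $$\mathsf{D}(C_n^r) \sim rn \qquad (n \to \infty),$$ that is, $\lim_{n\to\infty} \mathsf{D}(C_n^r)/(rn) = 1$. -/

import Mathlib

/-- A sequence over `G` (a finite unordered sequence in which repetition is allowed) has a non-empty
zero-sum subsequence. The length of `S` is `S.card`, its subsequences are the `T ≤ S`. -/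
def HasZeroSumSubsequence {G : Type*} [AddCommGroup G] (S : Multiset G) : Prop :=
  ∃ T : Multiset G, T ≤ S ∧ T ≠ 0 ∧ T.sum = 0

/-- The Davenport constant of a finite abelian group `G`: the smallest integer `t ≥ 1` such that
every sequence over `G` of length at least `t` has a non-empty zero-sum subsequence. -/
noncomputable def davenport (G : Type*) [AddCommGroup G] : ℕ :=
  sInf {t : ℕ | 1 ≤ t ∧ ∀ S : Multiset G, t ≤ S.card → HasZeroSumSubsequence S}

/-- For a finite group the minimum in the definition of the Davenport constant is attained. -/
theorem davenport_isLeast (G : Type*) [AddCommGroup G] [Finite G] :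
    IsLeast {t : ℕ | 1 ≤ t ∧ ∀ S : Multiset G, t ≤ S.card → HasZeroSumSubsequence S}
      (davenport G) := by
  have hne : {t : ℕ | 1 ≤ t ∧ ∀ S : Multiset G, t ≤ S.card →
      HasZeroSumSubsequence S}.Nonempty := by
    refine ⟨Nat.card G, Nat.card_pos, fun S hS => ?_⟩
    induction S using Quotient.inductionOn with
    | _ l =>
    have hl : Nat.card G ≤ l.length := by simpa using hS
    have hninj : ¬ Function.Injective (fun i : Fin (Nat.card G + 1) => (l.take i.1).sum) := by
      intro h
      have := Nat.card_le_card_of_injective _ h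
      simp at this
    have key : ∀ i j : Fin (Nat.card G + 1), i.1 < j.1 → (l.take i.1).sum = (l.take j.1).sum →
        HasZeroSumSubsequence (l : Multiset G) := by
      intro i j hij h
      refine ⟨((l.take j.1).drop i.1 : List G), ?_, ?_, ?_⟩
      · exact Multiset.coe_le.2
          (((List.drop_sublist _ _).trans (List.take_sublist _ _)).subperm)
      · intro h0
        have h1 := congrArg Multiset.card h0
        have := j.2
        simp at h1
        omega
      · have h2 := List.sum_take_add_sum_drop (l.take j.1) i.1
        rw [List.take_take, min_eq_left hij.le, h] at h2
        simpa using h2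
    simp only [Function.Injective, not_forall] at hninj
    obtain ⟨i, j, hij, hne⟩ := hninj
    rcases lt_or_gt_of_ne (fun h => hne (Fin.ext h)) with h | h
    · exact key i j h hij
    · exact key j i h hij.symm
  exact ⟨Nat.sInf_mem hne, fun t ht => Nat.sInf_le ht⟩

/-! Lower bound: `n - 1` copies of each basis vector have no non-empty zero-sum subsequence.

Upper bound: write `n = q * m` with `q` the largest prime power dividing `n`; then `q → ∞` with `n`.
Lift to `ℤ ^ r`. Olson's group-ring argument handles the modulus `q` with `r * q + 1` vectors, so it
suffices to extract that many disjoint subsequences with sums divisible by `m`, then divide those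
sums by `m`. They are extracted one prime factor `l ≤ q` of `m` at a time. The main cost is `l`
vectors per subsequence; the overhead is `B * l`, with `B` about `ε * q`. Over all factors the
overhead adds up to at most `2 * B * m`, which is about `2 * ε * n`.

The overhead is this small because `ε * p ^ 2 + K * p` vectors over `𝔽_p ^ r` always contain `p`
with sum zero (`exists_linear_bound_zero_sum_prime`), a weak Alon–Dubiner theorem. If many vectors
lie on an affine hyperplane, the dimension drops. Otherwise Fourier analysis shows that differences
of the vectors expand small sets, and greedily built subset sums of fixed length fill more than half
of the space. Two disjoint such families meet any prescribed total. -/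

section LongSequences

open Finset

/-! ### Expansion of small sets by well-spread shifts. -/

section Fourier

theorem card_dual_zmod {p : ℕ} [Fact p.Prime] {V : Type*} [AddCommGroup V]
    [Module (ZMod p) V] [Fintype V] [Fintype (Module.Dual (ZMod p) V)] :
    Fintype.card (Module.Dual (ZMod p) V) = Fintype.card V := by
  have : Module.Finite (ZMod p) V := Module.Finite.of_finite
  rw [Module.card_eq_pow_finrank (K := ZMod p) (V := V),
    Module.card_eq_pow_finrank (K := ZMod p) (V := Module.Dual (ZMod p) V),
    Subspace.dual_finrank_eq]

/-- Walking from `y` to `y + j • b` in steps of `b`, a point that ends outside `Y` must leave `Y` at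
one of the `j` steps. -/
theorem card_shift_nsmul_le {V : Type*} [AddCommGroup V] [DecidableEq V] (Y : Finset V) (b : V) (j : ℕ) :
    #{y ∈ Y | y + j • b ∉ Y} ≤ j * #{y ∈ Y | y + b ∉ Y} := by
  induction j with
  | zero => simp
  | succ j ih =>
    have hsub : {y ∈ Y | y + (j + 1) • b ∉ Y} ⊆
        {y ∈ Y | y + j • b ∉ Y} ∪
          ({y ∈ Y | y + b ∉ Y}).image (fun y => y - j • b) := by
      intro y hy
      simp only [mem_filter, mem_union, mem_image] at hy ⊢
      by_cases h : y + j • b ∈ Y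
      · right
        exact ⟨y + j • b, ⟨h, by rw [add_assoc, ← succ_nsmul]; exact hy.2⟩, by simp⟩
      · exact Or.inl ⟨hy.1, h⟩
    calc _ ≤ _ := card_le_card hsub
      _ ≤ _ := card_union_le _ _
      _ ≤ j * #{y ∈ Y | y + b ∉ Y} + #{y ∈ Y | y + b ∉ Y} := add_le_add ih card_image_le
      _ = _ := by ring

variable {p : ℕ} [Fact p.Prime] {V : Type*} [AddCommGroup V] [Module (ZMod p) V] [Fintype V]
  [DecidableEq V]

/-- The additive characters attached to the linear functionals separate the points of `V`. -/
theorem sum_dual_stdAddChar [Fintype (Module.Dual (ZMod p) V)] (x : V) :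
    ∑ φ : Module.Dual (ZMod p) V, ZMod.stdAddChar (φ x) =
      if x = 0 then (Fintype.card (Module.Dual (ZMod p) V) : ℂ) else 0 := by
  split_ifs with hx
  · simp [hx]
  · let ψ : AddChar (Module.Dual (ZMod p) V) ℂ :=
      (ZMod.stdAddChar (N := p)).compAddMonoidHom
        ((Module.Dual.eval (ZMod p) V x).toAddMonoidHom)
    have hψ : ψ ≠ 1 := by
      obtain ⟨φ, hφ⟩ : ∃ φ : Module.Dual (ZMod p) V, φ x ≠ 0 := by
        by_contra! h
        exact hx ((Module.forall_dual_apply_eq_zero_iff (ZMod p) x).1 h)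
      intro h
      have h1 : ψ φ = 1 := by rw [h]; rfl
      have h2 : ZMod.stdAddChar (φ x) = ZMod.stdAddChar (0 : ZMod p) := by
        rw [AddChar.map_zero_eq_one]; exact h1
      exact hφ (ZMod.injective_stdAddChar h2)
    exact AddChar.sum_eq_zero_of_ne_one hψ

/-- The square of the modulus of the Fourier transform of the indicator of `Y` at `φ`. -/
noncomputable def fourierSq (Y : Finset V) (φ : Module.Dual (ZMod p) V) : ℝ :=
  ‖∑ y ∈ Y, ZMod.stdAddChar (φ y)‖ ^ 2

theorem sum_fourierSq_mul [Fintype (Module.Dual (ZMod p) V)] (Y : Finset V) (x : V) :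
    ∑ φ : Module.Dual (ZMod p) V, fourierSq Y φ * (ZMod.stdAddChar (φ x) : ℂ).re =
      Fintype.card V * #{y ∈ Y | y + x ∈ Y} := by
  have key : ∑ φ : Module.Dual (ZMod p) V, (fourierSq Y φ : ℂ) * ZMod.stdAddChar (φ x) =
      Fintype.card V * #{y ∈ Y | y + x ∈ Y} := by
    have h1 : ∀ φ : Module.Dual (ZMod p) V, (fourierSq Y φ : ℂ) * ZMod.stdAddChar (φ x) =
        ∑ y ∈ Y, ∑ y' ∈ Y, ZMod.stdAddChar (φ (y + x - y')) := by
      intro φ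
      have : (fourierSq Y φ : ℂ) = (∑ y ∈ Y, ZMod.stdAddChar (φ y)) *
          ∑ y ∈ Y, ZMod.stdAddChar (-φ y) := by
        rw [fourierSq, ← Complex.normSq_eq_norm_sq, Complex.normSq_eq_conj_mul_self, mul_comm,
          map_sum]
        simp only [AddChar.map_neg_eq_conj]
      rw [this, sum_mul_sum, sum_mul]
      refine sum_congr rfl fun y _ => ?_
      rw [sum_mul]
      refine sum_congr rfl fun y' _ => ?_
      rw [← AddChar.map_add_eq_mul, ← AddChar.map_add_eq_mul]
      congr 1
      simp only [map_sub, map_add]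
      ring
    simp_rw [h1]
    rw [sum_comm]
    simp_rw [sum_comm (s := (univ : Finset (Module.Dual (ZMod p) V))), sum_dual_stdAddChar,
      card_dual_zmod, sub_eq_zero]
    have h2 : ∀ y ∈ Y, (∑ y' ∈ Y, if y + x = y' then (Fintype.card V : ℂ) else 0) =
        if y + x ∈ Y then (Fintype.card V : ℂ) else 0 := fun y _ => by rw [sum_ite_eq]
    rw [sum_congr rfl h2, ← sum_filter, sum_const, nsmul_eq_mul, mul_comm]
  have := congrArg Complex.re key
  rw [Complex.re_sum] at this
  simp only [Complex.re_ofReal_mul] at this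
  rw [this]
  norm_cast

theorem sum_fourierSq [Fintype (Module.Dual (ZMod p) V)] (Y : Finset V) :
    ∑ φ : Module.Dual (ZMod p) V, fourierSq Y φ = Fintype.card V * #Y := by
  simpa using sum_fourierSq_mul (p := p) Y 0

theorem sum_fourierSq_mul_one_sub [Fintype (Module.Dual (ZMod p) V)] (Y : Finset V) (x : V) :
    ∑ φ : Module.Dual (ZMod p) V, fourierSq Y φ * (1 - (ZMod.stdAddChar (φ x) : ℂ).re) =
      Fintype.card V * #{y ∈ Y | y + x ∉ Y} := by
  have h : (#{y ∈ Y | y + x ∈ Y} : ℝ) + #{y ∈ Y | y + x ∉ Y} = #Y := by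
    exact_mod_cast card_filter_add_card_filter_not (s := Y) (fun y => y + x ∈ Y)
  simp only [mul_sub, mul_one, sum_sub_distrib, sum_fourierSq_mul, sum_fourierSq]
  rw [← h]
  ring

/-- The norm is `2 * |sin (π * t / p)|`; the least absolute residue is at most `p / 2`, the range
where Jordan's inequality applies. -/
theorem norm_stdAddChar_sub_one_ge (t : ZMod p) :
    4 * (t.valMinAbs.natAbs : ℝ) / p ≤ ‖(ZMod.stdAddChar t : ℂ) - 1‖ := by
  have hp : (0 : ℝ) < p := by exact_mod_cast (Fact.out : p.Prime).pos
  have h1 : (ZMod.stdAddChar t : ℂ) =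
      Complex.exp (Complex.I * ((2 * Real.pi * t.valMinAbs / p : ℝ) : ℂ)) := by
    conv_lhs => rw [← ZMod.coe_valMinAbs t]
    rw [ZMod.stdAddChar_coe]
    congr 1
    push_cast
    ring
  rw [h1, Complex.norm_exp_I_mul_ofReal_sub_one]
  have habs : |(t.valMinAbs : ℝ)| = t.valMinAbs.natAbs := by
    rw [Nat.cast_natAbs, Int.cast_abs]
  have hle : (t.valMinAbs.natAbs : ℝ) ≤ p / 2 := by
    have h : (2 * t.valMinAbs.natAbs : ℕ) ≤ p := by
      have := ZMod.natAbs_valMinAbs_le t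
      omega
    have : (2 * t.valMinAbs.natAbs : ℝ) ≤ p := by exact_mod_cast h
    linarith
  set v : ℝ := (t.valMinAbs.natAbs : ℝ)
  have hv : 0 ≤ v := Nat.cast_nonneg _
  have h2 : 2 * Real.pi * t.valMinAbs / p / 2 = Real.pi / p * t.valMinAbs := by field_simp
  have hx0 : 0 ≤ Real.pi / p * v := by positivity
  have hx1 : Real.pi / p * v ≤ Real.pi / 2 := by
    calc Real.pi / p * v ≤ Real.pi / p * (p / 2) := by gcongr
      _ = Real.pi / 2 := by field_simp
  have h3 : |Real.sin (Real.pi / p * t.valMinAbs)| = Real.sin (Real.pi / p * v) := by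
    have hpos : 0 ≤ Real.sin (Real.pi / p * v) :=
      Real.sin_nonneg_of_nonneg_of_le_pi hx0 (by linarith [Real.pi_pos])
    rcases abs_choice (t.valMinAbs : ℝ) with h | h
    · rw [← h, habs, abs_of_nonneg hpos]
    · have : (t.valMinAbs : ℝ) = -v := by linarith
      rw [this, mul_neg, Real.sin_neg, abs_neg, abs_of_nonneg hpos]
  rw [h2, Real.norm_eq_abs, abs_mul, h3, abs_two]
  have h4 := Real.mul_le_sin hx0 hx1
  have h5 : 2 / Real.pi * (Real.pi / p * v) = 2 * v / p := by field_simp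
  rw [h5] at h4
  calc 4 * v / p = 2 * (2 * v / p) := by ring
    _ ≤ _ := by gcongr

theorem sum_one_sub_re_stdAddChar_ge {k J : ℕ} (hkJ : p ≤ k * J) (t : ZMod p)
    (ht : k ≤ t.valMinAbs.natAbs) :
    (J : ℝ) / 2 ≤ ∑ j ∈ range J, (1 - (ZMod.stdAddChar ((j : ZMod p) * t) : ℂ).re) := by
  have hp : (0 : ℝ) < p := by exact_mod_cast (Fact.out : p.Prime).pos
  have hkJ' : (p : ℝ) ≤ k * J := by exact_mod_cast hkJ
  have hk : (0 : ℝ) < k := by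
    rcases Nat.eq_zero_or_pos k with h | h
    · rw [h, Nat.cast_zero, zero_mul] at hkJ'; linarith
    · exact_mod_cast h
  set z : ℂ := ZMod.stdAddChar t
  have hz : 4 * (k : ℝ) / p ≤ ‖z - 1‖ := by
    refine le_trans ?_ (norm_stdAddChar_sub_one_ge t)
    gcongr
  have hz0 : 0 < ‖z - 1‖ := lt_of_lt_of_le (by positivity) hz
  have hpow : ∀ j : ℕ, (ZMod.stdAddChar ((j : ZMod p) * t) : ℂ) = z ^ j := by
    intro j
    rw [← nsmul_eq_mul, AddChar.map_nsmul_eq_pow]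
  have hnorm : ‖z‖ = 1 := AddChar.norm_apply _ _
  have hgeom : ‖∑ j ∈ range J, z ^ j‖ * ‖z - 1‖ ≤ 2 := by
    rw [← norm_mul, geom_sum_mul]
    calc ‖z ^ J - 1‖ ≤ ‖z ^ J‖ + ‖(1 : ℂ)‖ := norm_sub_le _ _
      _ = 2 := by rw [norm_pow, hnorm]; norm_num
  -- The geometric sum is at most `2 / ‖z - 1‖ ≤ p / (2 * k) ≤ J / 2`.
  have hle : ‖∑ j ∈ range J, z ^ j‖ ≤ J / 2 := by
    have h1 : ‖∑ j ∈ range J, z ^ j‖ * (4 * (k : ℝ) / p) ≤ 2 :=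
      le_trans (by gcongr) hgeom
    have h2 : (J : ℝ) / 2 * (4 * (k : ℝ) / p) ≥ 2 := by
      rw [ge_iff_le, div_mul_div_comm, le_div_iff₀ (by positivity)]
      linarith
    exact le_of_mul_le_mul_right (h1.trans h2) (by positivity)
  simp only [hpow, sum_sub_distrib, ← Complex.re_sum]
  have := Complex.re_le_norm (∑ j ∈ range J, z ^ j)
  simp only [sum_const, card_range, nsmul_eq_mul, mul_one]
  linarith

theorem card_valMinAbs_natAbs_lt_le (k : ℕ) :
    #{t : ZMod p | t.valMinAbs.natAbs < k} ≤ 2 * k := by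
  have hsub : ({t : ZMod p | t.valMinAbs.natAbs < k} : Finset (ZMod p)) ⊆
      (Ico (-(k : ℤ)) k).image (fun z : ℤ => (z : ZMod p)) := by
    intro t ht
    simp only [mem_filter, mem_univ, true_and] at ht
    exact mem_image.2 ⟨t.valMinAbs, by rw [mem_Ico]; omega, ZMod.coe_valMinAbs t⟩
  calc _ ≤ _ := card_le_card hsub
    _ ≤ _ := card_image_le
    _ = 2 * k := by rw [Int.card_Ico]; omega

/-- A family that is not concentrated on few affine hyperplanes expands small sets. -/
theorem exists_shift_expanding {ι : Type*} (I : Finset ι) (hI : I.Nonempty) (b : ι → V)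
    (Y : Finset V) (hY : Y.Nonempty) (hYV : 2 * #Y ≤ Fintype.card V) {k J M : ℕ} (hkJ : p ≤ k * J)
    (hM : ∀ φ : Module.Dual (ZMod p) V, φ ≠ 0 → ∀ c, #{i ∈ I | φ (b i) = c} ≤ M)
    (hkM : 4 * k * M ≤ #I) :
    ∃ i ∈ I, #Y ≤ 8 * J * #{y ∈ Y | y + b i ∉ Y} := by
  classical
  have : Finite (Module.Dual (ZMod p) V) := DFunLike.finite _
  have := Fintype.ofFinite (Module.Dual (ZMod p) V)
  have hJ : 0 < J := by
    rcases Nat.eq_zero_or_pos J with h | h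
    · have := (Fact.out : p.Prime).pos
      simp [h] at hkJ; omega
    · exact h
  by_contra! hcon
  have hYpos : (0 : ℝ) < #Y := by exact_mod_cast hY.card_pos
  have hIpos : (0 : ℝ) < #I := by exact_mod_cast hI.card_pos
  have hVpos : (0 : ℝ) < Fintype.card V := by exact_mod_cast Fintype.card_pos
  have hJpos : (0 : ℝ) < J := by exact_mod_cast hJ
  have hnonneg : ∀ (t : ZMod p), 0 ≤ 1 - (ZMod.stdAddChar t : ℂ).re := by
    intro t
    have := Complex.re_le_norm (ZMod.stdAddChar t : ℂ)
    rw [AddChar.norm_apply] at this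
    linarith
  -- Averaging over multiples `j • b i` makes every nonzero frequency count; `card_shift_nsmul_le`
  -- then returns to the single shift `b i` at the cost of a factor `J`.
  set w : Module.Dual (ZMod p) V → ℝ := fun φ =>
    ∑ i ∈ I, ∑ j ∈ range J, (1 - (ZMod.stdAddChar ((j : ZMod p) * φ (b i)) : ℂ).re)
  have hw0 : ∀ φ, 0 ≤ w φ := fun φ => sum_nonneg fun i _ => sum_nonneg fun j _ => hnonneg _
  have hw : ∀ φ, φ ≠ 0 → (#I * J / 4 : ℝ) ≤ w φ := by
    intro φ hφ
    have hfew : #{i ∈ I | (φ (b i)).valMinAbs.natAbs < k} ≤ 2 * k * M := by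
      have hmaps : ∀ i ∈ ({i ∈ I | (φ (b i)).valMinAbs.natAbs < k} : Finset ι),
          φ (b i) ∈ ({t : ZMod p | t.valMinAbs.natAbs < k} : Finset (ZMod p)) := by
        intro i hi
        simpa using (mem_filter.1 hi).2
      calc _ ≤ M * #({t : ZMod p | t.valMinAbs.natAbs < k} : Finset (ZMod p)) := by
            refine card_le_mul_card_image_of_maps_to hmaps M fun c _ => ?_
            exact (card_le_card (filter_subset_filter _ (filter_subset _ _))).trans (hM φ hφ c)
        _ ≤ M * (2 * k) := by gcongr; exact card_valMinAbs_natAbs_lt_le k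
        _ = _ := by ring
    have hmany : (#I : ℝ) / 2 ≤ #{i ∈ I | ¬ (φ (b i)).valMinAbs.natAbs < k} := by
      have := card_filter_add_card_filter_not (s := I) (fun i => (φ (b i)).valMinAbs.natAbs < k)
      have h2 : #I ≤ 2 * #{i ∈ I | ¬ (φ (b i)).valMinAbs.natAbs < k} := by nlinarith
      have h3 : (#I : ℝ) ≤ 2 * #{i ∈ I | ¬ (φ (b i)).valMinAbs.natAbs < k} := by exact_mod_cast h2
      linarith
    calc (#I * J / 4 : ℝ) = #I / 2 * (J / 2) := by ring
      _ ≤ #{i ∈ I | ¬ (φ (b i)).valMinAbs.natAbs < k} * (J / 2) := by gcongr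
      _ = ∑ i ∈ I with ¬ (φ (b i)).valMinAbs.natAbs < k, (J / 2 : ℝ) := by
          rw [sum_const, nsmul_eq_mul]
      _ ≤ ∑ i ∈ I with ¬ (φ (b i)).valMinAbs.natAbs < k,
            ∑ j ∈ range J, (1 - (ZMod.stdAddChar ((j : ZMod p) * φ (b i)) : ℂ).re) :=
          sum_le_sum fun i hi =>
            sum_one_sub_re_stdAddChar_ge hkJ _ (not_lt.1 (mem_filter.1 hi).2)
      _ ≤ w φ := sum_le_sum_of_subset_of_nonneg (filter_subset _ _)
            fun i _ _ => sum_nonneg fun j _ => hnonneg _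
  have hsq0 : ∀ φ : Module.Dual (ZMod p) V, 0 ≤ fourierSq Y φ := fun φ => sq_nonneg _
  have htotal : ∑ φ, fourierSq Y φ * w φ =
      ∑ i ∈ I, ∑ j ∈ range J, (Fintype.card V : ℝ) * #{y ∈ Y | y + j • b i ∉ Y} := by
    simp only [w, mul_sum]
    rw [sum_comm]
    refine sum_congr rfl fun i _ => ?_
    rw [sum_comm]
    refine sum_congr rfl fun j _ => ?_
    rw [← sum_fourierSq_mul_one_sub (p := p)]
    simp [nsmul_eq_mul]
  -- The zero frequency carries `#Y ^ 2`, at most half of the total mass `|V| * #Y`, since `Y` fills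
  -- at most half of `V`.
  have hlower : (#I * J / 4 : ℝ) * (Fintype.card V * #Y / 2) ≤ ∑ φ, fourierSq Y φ * w φ := by
    have h0 : fourierSq Y (0 : Module.Dual (ZMod p) V) = (#Y : ℝ) ^ 2 := by
      simp [fourierSq]
    set E : Finset (Module.Dual (ZMod p) V) := univ.erase 0 with hE
    have hsplit := add_sum_erase univ (fun φ => fourierSq Y φ)
      (mem_univ (0 : Module.Dual (ZMod p) V))
    rw [← hE] at hsplit
    simp only [sum_fourierSq, h0] at hsplit
    have hYV' : (2 * #Y : ℝ) ≤ Fintype.card V := by exact_mod_cast hYV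
    calc (#I * J / 4 : ℝ) * (Fintype.card V * #Y / 2)
        ≤ (#I * J / 4 : ℝ) * ∑ φ ∈ E, fourierSq Y φ := by
          refine mul_le_mul_of_nonneg_left ?_ (by positivity)
          nlinarith
      _ = ∑ φ ∈ E, fourierSq Y φ * (#I * J / 4 : ℝ) := by rw [mul_comm, sum_mul]
      _ ≤ ∑ φ ∈ E, fourierSq Y φ * w φ :=
          sum_le_sum fun φ hφ => mul_le_mul_of_nonneg_left (hw φ (ne_of_mem_erase hφ)) (hsq0 φ)
      _ ≤ _ := sum_le_sum_of_subset_of_nonneg (erase_subset _ _)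
          fun φ _ _ => mul_nonneg (hsq0 φ) (hw0 φ)
  have hupper : ∑ i ∈ I, ∑ j ∈ range J, (Fintype.card V : ℝ) * #{y ∈ Y | y + j • b i ∉ Y} <
      ∑ i ∈ I, ∑ j ∈ range J, (Fintype.card V : ℝ) * (#Y / 8) := by
    refine sum_lt_sum_of_nonempty hI fun i hi =>
      sum_lt_sum_of_nonempty (nonempty_range_iff.2 hJ.ne') fun j hj => ?_
    gcongr
    have h1 : 8 * #{y ∈ Y | y + j • b i ∉ Y} < #Y := by
      have h2 := card_shift_nsmul_le Y (b i) j
      have h3 : j * #{y ∈ Y | y + b i ∉ Y} ≤ J * #{y ∈ Y | y + b i ∉ Y} :=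
        Nat.mul_le_mul_right _ (mem_range.1 hj).le
      have := hcon i hi
      nlinarith
    have h1' : (8 * #{y ∈ Y | y + j • b i ∉ Y} : ℝ) < #Y := by exact_mod_cast h1
    linarith
  rw [htotal] at hlower
  have := hlower.trans_lt hupper
  simp only [sum_const, card_range, nsmul_eq_mul] at this
  nlinarith

end Fourier

/-! ### Greedy growth of subset sums of fixed length. -/

section Greedy

/-- The sums of the `t`-element subfamilies of `(a i)` with indices in `R`. -/
def subfamilySums {ι V : Type*} [AddCommGroup V] [DecidableEq V] (a : ι → V) (R : Finset ι)
    (t : ℕ) : Finset V :=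
  (R.powersetCard t).image fun A => ∑ i ∈ A, a i

theorem add_mem_subfamilySums {ι V : Type*} [AddCommGroup V] [DecidableEq V] [DecidableEq ι]
    {a : ι → V} {R R' : Finset ι} {t : ℕ} (hR : R ⊆ R') {i : ι} (hi : i ∉ R) (hi' : i ∈ R')
    {y : V} (hy : y ∈ subfamilySums a R t) : y + a i ∈ subfamilySums a R' (t + 1) := by
  simp only [subfamilySums, mem_image, mem_powersetCard] at hy ⊢
  obtain ⟨A, ⟨hA, hAc⟩, rfl⟩ := hy
  have hiA : i ∉ A := fun h => hi (hA h)
  refine ⟨insert i A, ⟨insert_subset hi' (hA.trans hR), ?_⟩, ?_⟩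
  · rw [card_insert_of_notMem hiA, hAc]
  · rw [sum_insert hiA, add_comm]

variable {p : ℕ} [Fact p.Prime] {V : Type*} [AddCommGroup V] [Module (ZMod p) V] [Fintype V]
  [DecidableEq V]

/-- Each step adds a pair of indices and uses exactly one of them. The new sums contain the
translates of the old set `Y` by `a i₀` and by `a i`; their union is as large as that of `Y` and `Y
+ (a i - a i₀)`, so an expanding difference gives a factor `1 + 1 / (8 * J)`. -/
theorem exists_subfamilySums_growth {ι : Type*} (I : Finset ι) (a : ι → V) {k J M T : ℕ}
    (hkJ : p ≤ k * J)
    (hM : ∀ φ : Module.Dual (ZMod p) V, φ ≠ 0 → ∀ c, #{i ∈ I | φ (a i) = c} ≤ M)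
    (hI : 4 * k * M + 2 * T ≤ #I) (t : ℕ) (ht : t ≤ T) :
    ∃ R ⊆ I, #R = 2 * t ∧ (Fintype.card V < 2 * #(subfamilySums a R t) ∨
      (1 + 1 / (8 * J) : ℝ) ^ t ≤ #(subfamilySums a R t)) := by
  classical
  have hJ : 0 < J := by
    rcases Nat.eq_zero_or_pos J with h | h
    · have := (Fact.out : p.Prime).pos
      simp [h] at hkJ; omega
    · exact h
  induction t with
  | zero => exact ⟨∅, by simp, by simp, Or.inr (by simp [subfamilySums])⟩
  | succ t ih =>
    obtain ⟨R, hRI, hRc, hR⟩ := ih (by omega)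
    have hcard : #(I \ R) = #I - #R := card_sdiff_of_subset hRI
    obtain ⟨i₀, hi₀⟩ : (I \ R).Nonempty := card_pos.1 (by omega)
    have extend : ∀ i ∈ I \ R, i ≠ i₀ →
        R ∪ {i₀, i} ⊆ I ∧ #(R ∪ {i₀, i}) = 2 * (t + 1) ∧
        (∀ y ∈ subfamilySums a R t, y + a i₀ ∈ subfamilySums a (R ∪ {i₀, i}) (t + 1)) ∧
        (∀ y ∈ subfamilySums a R t, y + a i ∈ subfamilySums a (R ∪ {i₀, i}) (t + 1)) := by
      intro i hi hne
      rw [mem_sdiff] at hi hi₀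
      refine ⟨?_, ?_, fun y hy => add_mem_subfamilySums subset_union_left hi₀.2 (by simp) hy,
        fun y hy => add_mem_subfamilySums subset_union_left hi.2 (by simp) hy⟩
      · exact union_subset hRI (by simp [insert_subset_iff, hi.1, hi₀.1])
      · rw [card_union_of_disjoint, hRc, card_pair hne.symm]
        · ring
        · simp [hi.2, hi₀.2]
    -- Past half of `V` expansion is no longer available, but any further pair preserves the size by
    -- translation.
    by_cases hlarge : Fintype.card V < 2 * #(subfamilySums a R t)
    · obtain ⟨i, hi⟩ : ((I \ R).erase i₀).Nonempty := by
        rw [← card_pos, card_erase_of_mem hi₀]; omega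
      obtain ⟨h1, h2, h3, -⟩ := extend i (mem_of_mem_erase hi) (ne_of_mem_erase hi)
      refine ⟨_, h1, h2, Or.inl (hlarge.trans_le ?_)⟩
      exact Nat.mul_le_mul_left 2
        (card_le_card_of_injOn (· + a i₀) h3 (add_left_injective _).injOn)
    · have hR' := hR.resolve_left hlarge
      set Y := subfamilySums a R t with hYdef
      have hY : Y.Nonempty := by
        rw [← card_pos, ← Nat.cast_pos (α := ℝ)]
        exact lt_of_lt_of_le (by positivity) hR'
      obtain ⟨i, hi, hexp⟩ := exists_shift_expanding (p := p) (I \ R) ⟨i₀, hi₀⟩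
        (fun i => a i - a i₀) Y hY (not_lt.1 hlarge) (M := M) hkJ (fun φ hφ c => by
          refine (card_le_card ?_).trans (hM φ hφ (c + φ (a i₀)))
          intro i hi
          simp only [mem_filter, mem_sdiff, map_sub] at hi ⊢
          exact ⟨hi.1.1, by rw [← hi.2]; ring⟩) (by omega)
      have hne : i ≠ i₀ := by
        rintro rfl
        have h0 : ({y ∈ Y | y + (a i - a i) ∉ Y} : Finset V) = ∅ := by
          rw [filter_eq_empty_iff]
          simp
        rw [h0, card_empty, mul_zero] at hexp
        exact absurd hY.card_pos (by omega)
      obtain ⟨h1, h2, h3, h4⟩ := extend i hi hne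
      refine ⟨_, h1, h2, Or.inr ?_⟩
      have hgrow : #Y + #{y ∈ Y | y + (a i - a i₀) ∉ Y} ≤
          #(subfamilySums a (R ∪ {i₀, i}) (t + 1)) := by
        rw [← card_image_of_injective Y (add_left_injective (a i₀)),
          ← card_image_of_injective ({y ∈ Y | y + (a i - a i₀) ∉ Y}) (add_left_injective (a i)),
          ← card_union_of_disjoint]
        · refine card_le_card (union_subset ?_ ?_)
          · exact image_subset_iff.2 h3
          · exact image_subset_iff.2 fun y hy => h4 y (mem_filter.1 hy).1
        · rw [disjoint_left]
          intro x hx hx'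
          simp only [mem_image, mem_filter] at hx hx'
          obtain ⟨y, hy, rfl⟩ := hx
          obtain ⟨y', ⟨-, hy'⟩, h⟩ := hx'
          apply hy'
          have : y' + (a i - a i₀) = y := by rw [← add_sub_assoc, h, add_sub_cancel_right]
          rwa [this]
      have hgrow' : (#Y + #{y ∈ Y | y + (a i - a i₀) ∉ Y} : ℝ) ≤
          #(subfamilySums a (R ∪ {i₀, i}) (t + 1)) := by exact_mod_cast hgrow
      have hexp' : (#Y : ℝ) ≤ 8 * J * #{y ∈ Y | y + (a i - a i₀) ∉ Y} := by exact_mod_cast hexp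
      have hJ' : (0 : ℝ) < 8 * J := by positivity
      have h5 : (#Y : ℝ) / (8 * J) ≤ #{y ∈ Y | y + (a i - a i₀) ∉ Y} := by
        rw [div_le_iff₀ hJ']; linarith
      calc (1 + 1 / (8 * J) : ℝ) ^ (t + 1) = (1 + 1 / (8 * J) : ℝ) ^ t * (1 + 1 / (8 * J)) :=
            pow_succ _ _
        _ ≤ #Y * (1 + 1 / (8 * J)) := by gcongr
        _ = #Y + #Y / (8 * J) := by ring
        _ ≤ _ := by linarith

end Greedy

/-! ### Zero sums of length exactly `p`. -/

/-- A weak form of the Alon–Dubiner theorem: long sequences over an `𝔽_p`-vector space have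
zero-sum subsequences of length exactly `p`. -/
theorem exists_card_eq_prime_sum_eq_zero {p : ℕ} [Fact p.Prime] {r k J T : ℕ} (hkJ : p ≤ k * J)
    (hT : 2 * T ≤ p) (hgrow : (p : ℝ) ^ r ≤ (1 + 1 / (8 * J) : ℝ) ^ T) {ι : Type*} (d : ℕ)
    (hd : d ≤ r) {V : Type*} [AddCommGroup V] [Module (ZMod p) V] [Finite V]
    (hV : Module.finrank (ZMod p) V = d) (I : Finset ι) (a : ι → V)
    (hI : (4 * k + 3) ^ d * p ≤ #I) :
    ∃ A ⊆ I, #A = p ∧ ∑ i ∈ A, a i = 0 := by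
  classical
  have hp : 0 < p := (Fact.out : p.Prime).pos
  induction d generalizing V I with
  | zero =>
    have : Module.Finite (ZMod p) V := Module.Finite.of_finite
    have hsub : Subsingleton V := Module.finrank_zero_iff.1 hV
    obtain ⟨A, hA, hAc⟩ := exists_subset_card_eq (s := I) (n := p) (by simpa using hI)
    exact ⟨A, hA, hAc, Subsingleton.elim _ _⟩
  | succ d ih =>
    have : Module.Finite (ZMod p) V := Module.Finite.of_finite
    by_cases hconc : ∃ φ : Module.Dual (ZMod p) V, φ ≠ 0 ∧
        ∃ c, (4 * k + 3) ^ d * p ≤ #{i ∈ I | φ (a i) = c}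
    · obtain ⟨φ, hφ, c, hc⟩ := hconc
      obtain ⟨i₀, hi₀⟩ : ({i ∈ I | φ (a i) = c}).Nonempty := by
        rw [← card_pos]
        exact lt_of_lt_of_le (by positivity) hc
      have hker := Module.Dual.finrank_ker_add_one_of_ne_zero hφ
      -- Translating by `a i₀` moves the hyperplane to `ker φ`. It does not affect sums of `p`
      -- terms, as `p • a i₀ = 0`. The default `0` is never taken on the fibre.
      obtain ⟨A, hA, hAc, hAs⟩ := ih (by omega) (V := LinearMap.ker φ) (by omega)
        {i ∈ I | φ (a i) = c}
        (fun i => if h : φ (a i - a i₀) = 0 then ⟨a i - a i₀, h⟩ else 0) hc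
      refine ⟨A, hA.trans (filter_subset _ _), hAc, ?_⟩
      have h1 := congrArg (Submodule.subtype _) hAs
      rw [map_sum, map_zero] at h1
      have h2 : ∀ i ∈ A, (Submodule.subtype (LinearMap.ker φ))
          (if h : φ (a i - a i₀) = 0 then ⟨a i - a i₀, h⟩ else 0) = a i - a i₀ := by
        intro i hi
        have h : φ (a i - a i₀) = 0 := by
          rw [map_sub, (mem_filter.1 (hA hi)).2, (mem_filter.1 hi₀).2, sub_self]
        rw [dif_pos h]; rfl
      rw [sum_congr rfl h2, sum_sub_distrib, sum_const, hAc, ← Nat.cast_smul_eq_nsmul (ZMod p),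
        CharP.cast_eq_zero, zero_smul, sub_zero] at h1
      exact h1
    · push Not at hconc
      have := Fintype.ofFinite V
      set M := (4 * k + 3) ^ d * p with hMdef
      have hMp : p ≤ M := Nat.le_mul_of_pos_left _ (by positivity)
      have hI' : 4 * k * M + 3 * p ≤ #I := by
        refine le_trans ?_ hI
        have : (4 * k + 3) ^ (d + 1) * p = (4 * k + 3) * M := by rw [hMdef]; ring
        nlinarith
      have hVcard : (Fintype.card V : ℝ) ≤ (1 + 1 / (8 * J) : ℝ) ^ T := by
        refine le_trans ?_ hgrow
        rw [Module.card_eq_pow_finrank (K := ZMod p) (V := V), hV, ZMod.card, Nat.cast_pow]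
        exact pow_le_pow_right₀ (by exact_mod_cast hp) hd
      have hVpos : 0 < Fintype.card V := Fintype.card_pos
      have half : ∀ I' ⊆ I, 4 * k * M + 2 * T ≤ #I' → ∃ R ⊆ I', #R = 2 * T ∧
          Fintype.card V < 2 * #(subfamilySums a R T) := by
        intro I' hI'I hI'c
        obtain ⟨R, hR, hRc, h⟩ := exists_subfamilySums_growth I' a hkJ
          (fun φ hφ c => (card_le_card (filter_subset_filter _ hI'I)).trans (hconc φ hφ c).le)
          hI'c T le_rfl
        refine ⟨R, hR, hRc, h.elim id fun h => ?_⟩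
        have : Fintype.card V ≤ #(subfamilySums a R T) := by exact_mod_cast hVcard.trans h
        omega
      obtain ⟨R₁, hR₁, hR₁c, hS₁⟩ := half I subset_rfl (by omega)
      have hc₁ := card_sdiff_of_subset hR₁
      obtain ⟨R₂, hR₂, hR₂c, hS₂⟩ := half (I \ R₁) sdiff_subset (by omega)
      have hc₂ := card_sdiff_of_subset hR₂
      -- Filler that brings the length `T + T` up to exactly `p`.
      obtain ⟨R₃, hR₃, hR₃c⟩ := exists_subset_card_eq (s := (I \ R₁) \ R₂) (n := p - 2 * T)
        (by omega)
      -- Two subsets of `V`, each with more than half of its elements, intersect.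
      obtain ⟨x, hx⟩ := inter_nonempty_of_card_lt_card_add_card
        (u := subfamilySums a R₁ T)
        (t := (subfamilySums a R₂ T).image fun y => -(∑ i ∈ R₃, a i) - y)
        (s := univ) (subset_univ _) (subset_univ _) (by
          rw [card_image_of_injective _ (sub_right_injective), card_univ]; omega)
      simp only [subfamilySums, mem_inter, mem_image, mem_powersetCard] at hx
      obtain ⟨⟨y, ⟨A₂, ⟨hA₂, hA₂c⟩, rfl⟩, hy⟩, A₁, ⟨hA₁, hA₁c⟩, rfl⟩ := hx
      have hd₁₂ : Disjoint A₁ A₂ :=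
        (disjoint_sdiff.mono_right (hA₂.trans hR₂)).mono_left hA₁
      have hd₃ : Disjoint (A₁ ∪ A₂) R₃ := by
        rw [disjoint_union_left]
        exact ⟨(disjoint_sdiff.mono_right (hR₃.trans sdiff_subset)).mono_left hA₁,
          (disjoint_sdiff.mono_right hR₃).mono_left hA₂⟩
      refine ⟨A₁ ∪ A₂ ∪ R₃, union_subset (union_subset (hA₁.trans hR₁)
        (hA₂.trans (hR₂.trans sdiff_subset)))
        (hR₃.trans (sdiff_subset.trans sdiff_subset)), ?_, ?_⟩
      · rw [card_union_of_disjoint hd₃, card_union_of_disjoint hd₁₂]; omega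
      · rw [sum_union hd₃, sum_union hd₁₂, ← hy]; abel

/-! ### Choice of parameters. -/

section Asymptotics

open Filter Asymptotics

theorem eventually_mul_natLog_pow_le {a : ℝ} (ha : 0 < a) (r : ℕ) {ε : ℝ} (hε : 0 < ε) :
    ∀ᶠ p : ℕ in atTop, (a * (Nat.log 2 p + 1 : ℝ)) ^ r ≤ ε * p := by
  have hlittle : (fun p : ℕ => (Real.log p) ^ r) =o[atTop] (fun p : ℕ => (p : ℝ)) :=
    (Real.isLittleO_pow_log_id_atTop (n := r)).comp_tendsto tendsto_natCast_atTop_atTop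
  set C : ℝ := a * (1 / Real.log 2 + 1) with hC
  have hlog2 : 0 < Real.log 2 := Real.log_pos one_lt_two
  have hCpos : 0 < C := by positivity
  have h1 := hlittle.bound (show 0 < ε / C ^ r by positivity)
  filter_upwards [h1, eventually_ge_atTop 3] with p hp hp3
  have hlog : 1 ≤ Real.log p := by
    rw [Real.le_log_iff_exp_le (by positivity)]
    have : (3 : ℝ) ≤ p := by exact_mod_cast hp3
    linarith [Real.exp_one_lt_d9]
  have hnat : (Nat.log 2 p : ℝ) ≤ Real.log p / Real.log 2 := by
    rw [le_div_iff₀ hlog2, ← Real.log_pow]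
    refine Real.log_le_log (by positivity) ?_
    exact_mod_cast Nat.pow_log_le_self 2 (by omega)
  have hbase : a * (Nat.log 2 p + 1 : ℝ) ≤ C * Real.log p := by
    rw [hC, mul_assoc]
    gcongr
    have : (1 / Real.log 2 + 1) * Real.log p = Real.log p / Real.log 2 + Real.log p := by ring
    linarith
  rw [Real.norm_of_nonneg (by positivity), Real.norm_of_nonneg (by positivity)] at hp
  calc _ ≤ (C * Real.log p) ^ r := by gcongr
    _ = C ^ r * Real.log p ^ r := mul_pow _ _ _
    _ ≤ C ^ r * (ε / C ^ r * p) := by gcongr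
    _ = ε * p := by field_simp

end Asymptotics

/-- Long sequences over `𝔽_p ^ r` have zero-sum subsequences of length `p`, with a bound on the
length that is `o(p ^ 2)`. -/
theorem exists_linear_bound_zero_sum_prime (r : ℕ) (hr : 1 ≤ r) {ε : ℝ} (hε : 0 < ε) :
    ∃ K : ℝ, ∀ p : ℕ, p.Prime → ∀ {ι : Type} (I : Finset ι) (a : ι → Fin r → ZMod p),
      (ε * p + K) * p ≤ #I → ∃ A ⊆ I, #A = p ∧ ∑ i ∈ A, a i = 0 := by
  classical
  obtain ⟨p₀, hp₀⟩ := Filter.eventually_atTop.1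
    ((eventually_mul_natLog_pow_le (a := 128 * r + 7) (by positivity) r hε).and
      (eventually_mul_natLog_pow_le (a := 16 * r) (by positivity) 1 one_pos))
  refine ⟨(p₀ : ℝ) ^ r, fun p hp ι I a hI => ?_⟩
  have : Fact p.Prime := ⟨hp⟩
  have hppos : (0 : ℝ) < p := by exact_mod_cast hp.pos
  rcases lt_or_ge p p₀ with hlt | hge
  -- For the finitely many small primes, `K = p₀ ^ r` is large enough to force one vector to occur
  -- `p` times.
  · have hI' : Fintype.card (Fin r → ZMod p) * p ≤ #I := by
      have h1 : ((p ^ r * p : ℕ) : ℝ) ≤ #I := by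
        push_cast
        refine le_trans ?_ hI
        gcongr
        have : (p : ℝ) ^ r ≤ (p₀ : ℝ) ^ r := by gcongr
        have : 0 < ε * p := by positivity
        linarith
      simpa [ZMod.card] using (by exact_mod_cast h1 : p ^ r * p ≤ #I)
    obtain ⟨y, -, hy⟩ := exists_le_card_fiber_of_mul_le_card_of_maps_to
      (s := I) (t := (univ : Finset (Fin r → ZMod p))) (f := a) (fun _ _ => mem_univ _)
      univ_nonempty (n := p) (by rwa [card_univ])
    obtain ⟨A, hA, hAc⟩ := exists_subset_card_eq hy
    refine ⟨A, hA.trans (filter_subset _ _), hAc, ?_⟩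
    rw [sum_congr rfl (fun i hi => (mem_filter.1 (hA hi)).2), sum_const, hAc]
    ext i
    simp
  · obtain ⟨hpow, hlog⟩ := hp₀ p hge
    replace hlog : 16 * r * (Nat.log 2 p + 1) ≤ p := by
      rw [pow_one, one_mul] at hlog
      exact_mod_cast hlog
    set l := Nat.log 2 p + 1 with hl
    -- With `T = 8 * J * (r * l)`, this gives `2 * T ≤ p`. By Bernoulli each block of `8 * J` steps
    -- doubles the set, so `T` steps reach `2 ^ (r * l) ≥ p ^ r`. The resulting `k` is only
    -- logarithmic in `p`.
    set J := p / (16 * r * l) with hJ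
    have hrl : 0 < 16 * r * l := by positivity
    have hJpos : 0 < J := Nat.div_pos hlog hrl
    set k := p / J + 1 with hk
    have hkJ : p ≤ k * J := by
      have := Nat.lt_div_mul_add hJpos (a := p)
      rw [hk, add_mul, one_mul]
      omega
    have hk' : k ≤ 32 * r * l + 1 := by
      rw [hk]
      refine Nat.add_le_add_right ?_ 1
      refine Nat.div_le_of_le_mul ?_
      have h1 := Nat.lt_div_mul_add hrl (a := p)
      rw [← hJ] at h1
      nlinarith
    have hT : 2 * (8 * J * (r * l)) ≤ p := by
      have := Nat.div_mul_le_self p (16 * r * l)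
      rw [← hJ] at this
      nlinarith
    have hgrow : (p : ℝ) ^ r ≤ (1 + 1 / (8 * J) : ℝ) ^ (8 * J * (r * l)) := by
      have h2 : (2 : ℝ) ≤ (1 + 1 / (8 * J) : ℝ) ^ (8 * J) := by
        have := one_add_mul_le_pow (a := (1 / (8 * J) : ℝ))
          (by have : (0 : ℝ) ≤ 1 / (8 * J) := by positivity
              linarith) (8 * J)
        refine le_trans (le_of_eq ?_) this
        have : (J : ℝ) ≠ 0 := by positivity
        push_cast
        field_simp
        norm_num
      have h3 : (p : ℝ) ≤ 2 ^ l := by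
        exact_mod_cast (Nat.lt_pow_succ_log_self one_lt_two p).le
      calc (p : ℝ) ^ r ≤ (2 ^ l) ^ r := by gcongr
        _ = 2 ^ (r * l) := by rw [← pow_mul, mul_comm]
        _ ≤ ((1 + 1 / (8 * J) : ℝ) ^ (8 * J)) ^ (r * l) := by gcongr
        _ = _ := by rw [← pow_mul]
    refine exists_card_eq_prime_sum_eq_zero hkJ hT hgrow r le_rfl (by simp) I a ?_
    have h5 : ((4 * k + 3 : ℕ) : ℝ) ^ r ≤ ε * p := by
      refine le_trans ?_ hpow
      have h1 : 4 * k + 3 ≤ (128 * r + 7) * l := by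
        have : 1 ≤ l := Nat.le_add_left 1 _
        nlinarith
      have h2 : ((4 * k + 3 : ℕ) : ℝ) ≤ (((128 * r + 7) * l : ℕ) : ℝ) := by exact_mod_cast h1
      have h3 : (((128 * r + 7) * l : ℕ) : ℝ) = (128 * r + 7) * (Nat.log 2 p + 1 : ℝ) := by
        rw [hl]; push_cast; ring
      rw [← h3]
      gcongr
    have h6 : (((4 * k + 3) ^ r * p : ℕ) : ℝ) ≤ #I := by
      refine le_trans ?_ hI
      push_cast at h5 ⊢
      gcongr
      have : (0 : ℝ) ≤ (p₀ : ℝ) ^ r := by positivity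
      linarith
    exact_mod_cast h6

end LongSequences

/-! ### Disjoint subsequences with sums divisible by `d`. -/

namespace Multiset

theorem exists_le_map_eq_of_le_map {α β : Type*} {f : α → β} {s : Multiset α} {u : Multiset β}
    (h : u ≤ s.map f) : ∃ t ≤ s, t.map f = u := by
  classical
  induction s using Multiset.induction generalizing u with
  | empty => exact ⟨0, le_rfl, by simpa using (h.antisymm (Multiset.zero_le _)).symm⟩
  | cons a s ih =>
    rw [map_cons] at h
    by_cases ha : f a ∈ u
    · obtain ⟨v, rfl⟩ := exists_cons_of_mem ha
      obtain ⟨t, ht, rfl⟩ := ih ((cons_le_cons_iff _).1 h)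
      exact ⟨a ::ₘ t, cons_le_cons _ ht, map_cons _ _ _⟩
    · obtain ⟨t, ht, rfl⟩ := ih ((le_cons_of_notMem ha).1 h)
      exact ⟨t, ht.trans (le_cons_self _ _), rfl⟩

theorem exists_map_map_eq_of_sum_le_map {α β : Type*} {f : α → β} {s : Multiset α}
    {l : Multiset (Multiset β)} (h : l.sum ≤ s.map f) :
    ∃ l' : Multiset (Multiset α), l'.sum ≤ s ∧ l'.map (map f) = l := by
  classical
  induction l using Multiset.induction generalizing s with
  | empty => exact ⟨0, by simp, rfl⟩
  | cons u l ih =>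
    rw [sum_cons] at h
    obtain ⟨t, ht, rfl⟩ := exists_le_map_eq_of_le_map ((le_add_right _ _).trans h)
    have hs : s = t + (s - t) := (add_tsub_cancel_of_le ht).symm
    rw [hs, map_add] at h
    obtain ⟨l', hl', rfl⟩ := ih (le_of_add_le_add_left h)
    refine ⟨t ::ₘ l', ?_, by simp⟩
    rw [sum_cons, hs]
    gcongr

end Multiset

/-- Every sequence of at least `N` vectors of `ℤ ^ r` contains `t` disjoint non-empty subsequences
whose sums are divisible by `d`. -/
def SplitsInto (r d N t : ℕ) : Prop :=
  ∀ S : Multiset (Fin r → ℤ), N ≤ S.card → ∃ l : Multiset (Multiset (Fin r → ℤ)),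
    l.card = t ∧ l.sum ≤ S ∧ ∀ T ∈ l, T ≠ 0 ∧ ∃ y : Fin r → ℤ, T.sum = (d : ℤ) • y

namespace SplitsInto

variable {r : ℕ}

theorem one (t : ℕ) : SplitsInto r 1 t t := by
  intro S hS
  obtain ⟨S', hS', hc⟩ : ∃ S' ≤ S, S'.card = t := by
    induction S using Quotient.inductionOn with
    | _ L =>
      exact ⟨(L.take t : List _), Multiset.coe_le.2 (L.take_sublist t).subperm, by simpa using hS⟩
  refine ⟨S'.map fun x => {x}, by simpa using hc, by simpa using hS', ?_⟩
  intro T hT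
  obtain ⟨x, -, rfl⟩ := Multiset.mem_map.1 hT
  exact ⟨by simp, x, by simp⟩

theorem mono {d N N' t : ℕ} (h : SplitsInto r d N t) (hN : N ≤ N') : SplitsInto r d N' t :=
  fun S hS => h S (hN.trans hS)

/-- The quotients by `d₁` of the first sums form a new sequence; splitting it for `d₂` groups the
first subsequences, and each group is merged into one subsequence. -/
theorem mul {d₁ d₂ N t₁ t₂ : ℕ} (h₁ : SplitsInto r d₁ N t₁) (h₂ : SplitsInto r d₂ t₁ t₂) :
    SplitsInto r (d₁ * d₂) N t₂ := by
  classical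
  intro S hS
  obtain ⟨l, hlc, hl, hlT⟩ := h₁ S hS
  choose! y hy using fun T hT => (hlT T hT).2
  obtain ⟨m, hmc, hm, hmT⟩ := h₂ (l.map y) (by rw [Multiset.card_map, hlc])
  obtain ⟨m', hm', rfl⟩ := Multiset.exists_map_map_eq_of_sum_le_map hm
  have hmem : ∀ U ∈ m', ∀ T ∈ U, T ∈ l := fun U hU T hT =>
    Multiset.mem_of_le ((Multiset.single_le_sum (fun _ _ => Multiset.zero_le _) U hU).trans hm') hT
  refine ⟨m'.map Multiset.sum, by simpa using hmc, ?_, ?_⟩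
  · refine le_trans ?_ hl
    obtain ⟨w, hw⟩ := Multiset.le_iff_exists_add.1 hm'
    rw [hw, Multiset.sum_add]
    refine le_trans (le_of_eq ?_) (Multiset.le_add_right _ _)
    clear hmT hm hmc hm' hmem hw
    induction m' using Multiset.induction with
    | empty => simp
    | cons a m' ih => simp [ih]
  · intro T hT
    obtain ⟨U, hU, rfl⟩ := Multiset.mem_map.1 hT
    obtain ⟨hU0, z, hz⟩ := hmT _ (Multiset.mem_map_of_mem _ hU)
    constructor
    · intro h0
      have hU0' : U ≠ 0 := by
        rintro rfl
        exact hU0 rfl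
      obtain ⟨T, hT⟩ := Multiset.exists_mem_of_ne_zero hU0'
      have := Multiset.single_le_sum (fun _ _ => Multiset.zero_le _) T hT
      rw [h0] at this
      exact (hlT T (hmem U hU T hT)).1 (this.antisymm (Multiset.zero_le _))
    · refine ⟨z, ?_⟩
      have hsum : U.sum.sum = (U.map fun T => (d₁ : ℤ) • y T).sum := by
        have h1 : U.map (fun T => (d₁ : ℤ) • y T) = U.map Multiset.sum :=
          Multiset.map_congr rfl fun T hT => (hy T (hmem U hU T hT)).symm
        rw [h1]
        clear hz hU0 hU h1 hT
        induction U using Multiset.induction with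
        | empty => simp
        | cons a U ih => simp [ih]
      rw [hsum, Nat.cast_mul, mul_smul, ← hz, Multiset.smul_sum, Multiset.map_map]
      rfl

/-- Repeated extraction of subsequences of length `p`. -/
theorem of_exists_card_eq {p E : ℕ}
    (h : ∀ S : Multiset (Fin r → ℤ), E ≤ S.card → ∃ T ≤ S, T.card = p ∧ T ≠ 0 ∧
      ∃ y : Fin r → ℤ, T.sum = (p : ℤ) • y) (t : ℕ) :
    SplitsInto r p (E + p * t) t := by
  classical
  induction t with
  | zero => exact fun S _ => ⟨0, by simp⟩
  | succ t ih =>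
    intro S hS
    obtain ⟨T, hTS, hTc, hT⟩ := h S (by omega)
    obtain ⟨l, hlc, hl, hlT⟩ := ih (S - T) (by
      rw [Multiset.card_sub hTS, hTc]
      rw [mul_add] at hS
      omega)
    refine ⟨T ::ₘ l, by simp [hlc], ?_, ?_⟩
    · rw [Multiset.sum_cons]
      calc T + l.sum ≤ T + (S - T) := by gcongr
        _ = S := add_tsub_cancel_of_le hTS
    · intro T' hT'
      rcases Multiset.mem_cons.1 hT' with rfl | hT'
      · exact hT
      · exact hlT T' hT'

/-- The form `2 * B * (m - 1)` is chosen to telescope: `(a - 1) + a * (b - 1) = a * b - 1`. The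
factor `2` starts it off, since `p ≤ 2 * (p - 1)` for a prime. -/
theorem of_prime_factors {B : ℕ} (m : ℕ) (hm : m ≠ 0)
    (h : ∀ p, p.Prime → p ∣ m → ∀ t, SplitsInto r p (B * p + p * t) t) (t : ℕ) :
    SplitsInto r m (2 * B * (m - 1) + m * t) t := by
  induction m using Nat.recOnMul generalizing t with
  | zero => exact absurd rfl hm
  | one => simpa using one t
  | prime p hp =>
    refine (h p hp dvd_rfl t).mono (Nat.add_le_add_right ?_ _)
    have := hp.two_le
    obtain ⟨q, rfl⟩ := Nat.exists_eq_add_of_le this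
    have : 2 + q - 1 = q + 1 := by omega
    rw [this]
    nlinarith [Nat.zero_le (B * q)]
  | mul a b iha ihb =>
    have ha : a ≠ 0 := left_ne_zero_of_mul hm
    have hb : b ≠ 0 := right_ne_zero_of_mul hm
    refine ((iha ha (fun p hp hpa => h p hp (hpa.mul_right b)) _).mul
      (ihb hb (fun p hp hpb => h p hp (hpb.mul_left a)) t)).mono (le_of_eq ?_)
    obtain ⟨a, rfl⟩ := Nat.exists_eq_succ_of_ne_zero ha
    obtain ⟨b, rfl⟩ := Nat.exists_eq_succ_of_ne_zero hb
    have : (a + 1) * (b + 1) - 1 = a * b + a + b := by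
      rw [Nat.sub_eq_iff_eq_add (Nat.mul_pos a.succ_pos b.succ_pos), Nat.succ_eq_add_one,
        Nat.succ_eq_add_one]; ring
    simp only [Nat.succ_eq_add_one, this, Nat.add_sub_cancel]
    ring

end SplitsInto

theorem exists_eq_smul_of_forall_cast_eq_zero {r d : ℕ} {x : Fin r → ℤ}
    (h : ∀ j, ((x j : ℤ) : ZMod d) = 0) : ∃ y : Fin r → ℤ, x = (d : ℤ) • y := by
  choose y hy using fun j => (ZMod.intCast_zmod_eq_zero_iff_dvd (x j) d).1 (h j)
  exact ⟨y, funext fun j => by simp [hy j]⟩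

theorem exists_splitsInto_prime (r : ℕ) (hr : 1 ≤ r) {ε : ℝ} (hε : 0 < ε) :
    ∃ K : ℝ, ∀ p B : ℕ, p.Prime → ε * p + K ≤ B → ∀ t, SplitsInto r p (B * p + p * t) t := by
  classical
  obtain ⟨K, hK⟩ := exists_linear_bound_zero_sum_prime r hr hε
  refine ⟨K, fun p B hp hB => SplitsInto.of_exists_card_eq fun S hS => ?_⟩
  -- `toEnumFinset` gives repeated vectors distinct indices.
  obtain ⟨A, hA, hAc, hAs⟩ := hK p hp S.toEnumFinset (fun i j => ((i.1 j : ℤ) : ZMod p)) (by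
    rw [Multiset.card_toEnumFinset]
    have h1 : ((B * p : ℕ) : ℝ) ≤ S.card := by exact_mod_cast hS
    refine le_trans ?_ h1
    push_cast
    gcongr)
  have hc : (A.1.map Prod.fst).card = p := by rw [Multiset.card_map]; exact hAc
  refine ⟨A.1.map Prod.fst, Multiset.map_fst_le_of_subset_toEnumFinset hA, hc, ?_, ?_⟩
  · intro h0
    rw [h0, Multiset.card_zero] at hc
    exact hp.ne_zero hc.symm
  · refine exists_eq_smul_of_forall_cast_eq_zero fun j => ?_
    have h1 := congrFun hAs j
    rw [Finset.sum_apply] at h1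
    have h2 : (A.1.map Prod.fst).sum = ∑ i ∈ A, i.1 := rfl
    rw [h2, Finset.sum_apply, Int.cast_sum]
    exact h1

/-! ### Olson's argument for prime powers. -/

section Olson

/-- Every term of the binomial expansion has at least `m` factors `I` or at least `n` factors `J`.
-/
theorem Ideal.sup_pow_add_le {R : Type*} [CommRing R] (I J : Ideal R) (m n : ℕ) :
    (I ⊔ J) ^ (m + n) ≤ I ^ m ⊔ J ^ n := by
  rw [← Submodule.add_eq_sup, add_pow, Ideal.sum_eq_sup]
  refine Finset.sup_le fun i hi => Ideal.mul_le_left.trans ?_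
  rcases le_or_gt m i with h | h
  · exact Ideal.mul_le_left.trans
      ((Ideal.pow_le_pow_right h).trans (le_sup_left (a := I ^ m) (b := J ^ n)))
  · have h' : n ≤ m + n - i := by omega
    exact Ideal.mul_le_right.trans
      ((Ideal.pow_le_pow_right h').trans (le_sup_right (a := I ^ m) (b := J ^ n)))

/-- The extra `1` in the exponent serves the empty family, where the zeroth power of `⊥` would be
the whole ring. -/
theorem Ideal.sup_pow_eq_bot {R ι : Type*} [CommRing R] (s : Finset ι) (I : ι → Ideal R) (q : ℕ)
    (h : ∀ i ∈ s, I i ^ q = ⊥) : (s.sup I) ^ (s.card * q + 1) = ⊥ := by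
  classical
  induction s using Finset.induction_on with
  | empty => simp
  | insert i s hi ih =>
    have h1 := Ideal.sup_pow_add_le (I i) (s.sup I) q (s.card * q + 1)
    rw [h i (by simp), ih fun j hj => h j (by simp [hj]), sup_bot_eq, le_bot_iff] at h1
    rw [Finset.sup_insert, Finset.card_insert_of_notMem hi, ← h1]
    congr 1
    ring

open AddMonoidAlgebra

/-- Expand the product over subsets and read off the coefficient at `0`: the empty subset
contributes `1`, and only a non-empty zero-sum subset could cancel it. -/
theorem exists_zero_sum_of_prod_one_sub_single_eq_zero {k G ι : Type*} [CommRing k] [Nontrivial k]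
    [AddCommGroup G] (I : Finset ι) (g : ι → G)
    (h : ∏ i ∈ I, (1 + -single (g i) (1 : k)) = 0) :
    ∃ A ⊆ I, A.Nonempty ∧ ∑ i ∈ A, g i = 0 := by
  classical
  by_contra! hcon
  have hterm : ∀ A : Finset ι,
      ∏ i ∈ A, -single (g i) (1 : k) = single (∑ i ∈ A, g i) ((-1) ^ A.card) := by
    intro A
    induction A using Finset.induction_on with
    | empty => simp [AddMonoidAlgebra.one_def]
    | insert i A hi ih =>
      rw [Finset.prod_insert hi, ih, Finset.sum_insert hi, Finset.card_insert_of_notMem hi,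
        pow_succ', neg_mul, single_mul_single, one_mul, neg_one_mul, single_neg]
  rw [Finset.prod_one_add] at h
  simp only [hterm] at h
  have hcoeff := congrArg (fun f => AddMonoidAlgebra.coeff f 0) h
  simp only [AddMonoidAlgebra.coeff_sum, AddMonoidAlgebra.coeff_single,
    AddMonoidAlgebra.coeff_zero, Finsupp.finsetSum_apply, Finsupp.coe_zero, Pi.zero_apply] at hcoeff
  rw [Finset.sum_eq_single_of_mem ∅ (by simp)] at hcoeff
  · simp at hcoeff
  · intro A hA hne
    rw [Finsupp.single_apply, if_neg]
    exact hcon A (Finset.mem_powerset.1 hA) (Finset.nonempty_iff_ne_empty.2 hne)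

/-- If `X ^ e - 1` lies in an ideal of the group ring for each `e` in a generating set, then so does
`X ^ v - 1` for every `v`. -/
theorem single_sub_one_mem_of_mem_closure {k G : Type*} [CommRing k] [AddCommGroup G]
    (N : Ideal (AddMonoidAlgebra k G)) {s : Set G}
    (hs : ∀ e ∈ s, single e (1 : k) - 1 ∈ N) {v : G} (hv : v ∈ AddSubmonoid.closure s) :
    single v (1 : k) - 1 ∈ N := by
  induction hv using AddSubmonoid.closure_induction with
  | mem e he => exact hs e he
  | zero => simp [AddMonoidAlgebra.one_def]
  | add v w _ _ hv hw =>
    have : single (v + w) (1 : k) - 1 =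
        single v 1 * (single w 1 - 1) + (single v 1 - 1) := by
      rw [mul_sub, single_mul_single, mul_one, mul_one]
      ring
    rw [this]
    exact N.add_mem (N.mul_mem_left _ hw) hv

/-- Olson's argument: in the group ring of `(ℤ/q) ^ r` over `𝔽_p`, `q` a power of `p`, every product
of `r * q + 1` elements `1 - X ^ g` vanishes. -/
theorem exists_zero_sum_prime_pow {r p a q : ℕ} [Fact p.Prime] (hq : q = p ^ a) {ι : Type*}
    (I : Finset ι) (g : ι → Fin r → ZMod q) (hI : r * q + 1 ≤ I.card) :
    ∃ A ⊆ I, A.Nonempty ∧ ∑ i ∈ A, g i = 0 := by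
  classical
  have : NeZero q := ⟨hq ▸ pow_ne_zero _ (Fact.out : p.Prime).ne_zero⟩
  have : CharP (AddMonoidAlgebra (ZMod p) (Fin r → ZMod q)) p :=
    charP_of_injective_algebraMap' (ZMod p) p
  let J : Fin r → Ideal (AddMonoidAlgebra (ZMod p) (Fin r → ZMod q)) :=
    fun j => Ideal.span {single (Pi.single j 1) 1 - 1}
  have hJ : ∀ j, J j ^ q = ⊥ := by
    intro j
    have hpow : (single (Pi.single j 1) 1 - 1 :
        AddMonoidAlgebra (ZMod p) (Fin r → ZMod q)) ^ q = 0 := by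
      -- Frobenius in characteristic `p`: `(X ^ e - 1) ^ q = X ^ (q • e) - 1`, which vanishes
      -- because `q • e = 0`.
      have h1 : (single (Pi.single j 1) 1 - 1 :
          AddMonoidAlgebra (ZMod p) (Fin r → ZMod q)) ^ p ^ a =
          single (Pi.single j 1) 1 ^ p ^ a - 1 ^ p ^ a := sub_pow_char_pow ..
      have h2 : q • (Pi.single j 1 : Fin r → ZMod q) = 0 := by
        ext i
        simp
      rw [← hq, one_pow, single_pow, one_pow, h2] at h1
      rw [h1]
      exact sub_self _
    rw [Ideal.span_singleton_pow, hpow]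
    simp
  have hNpow : (Finset.univ.sup J) ^ (r * q + 1) = ⊥ := by
    simpa using Ideal.sup_pow_eq_bot Finset.univ J q fun j _ => hJ j
  have hN : ∀ v, single v 1 - 1 ∈ Finset.univ.sup J := by
    intro v
    refine single_sub_one_mem_of_mem_closure _
      (s := Set.range fun j : Fin r => (Pi.single j 1 : Fin r → ZMod q)) ?_ ?_
    · rintro _ ⟨j, rfl⟩
      exact (Finset.le_sup (f := J) (Finset.mem_univ j)) (Ideal.subset_span rfl)
    · have hv : v = ∑ j, (v j).val • (Pi.single j 1 : Fin r → ZMod q) := by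
        ext i
        rw [Finset.sum_apply, Finset.sum_eq_single_of_mem i (Finset.mem_univ i)]
        · rw [Pi.smul_apply, Pi.single_eq_same, nsmul_eq_mul, mul_one, ZMod.natCast_zmod_val]
        · intro j _ hj
          rw [Pi.smul_apply, Pi.single_eq_of_ne hj.symm, smul_zero]
      rw [hv]
      exact sum_mem fun j _ =>
        AddSubmonoid.nsmul_mem _ (AddSubmonoid.subset_closure (Set.mem_range_self j)) _
  refine exists_zero_sum_of_prod_one_sub_single_eq_zero (k := ZMod p) I g ?_
  have h1 : ∏ i ∈ I, (1 + -single (g i) 1) ∈ ∏ _i ∈ I, Finset.univ.sup J :=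
    Ideal.prod_mem_prod fun i _ => by
      rw [← sub_eq_add_neg, ← neg_sub]
      exact neg_mem (hN _)
  rw [Finset.prod_const] at h1
  have h2 := Ideal.pow_le_pow_right hI h1
  rwa [hNpow] at h2

end Olson

theorem splitsInto_prime_pow (r p a : ℕ) (hp : p.Prime) :
    SplitsInto r (p ^ a) (r * p ^ a + 1) 1 := by
  classical
  have : Fact p.Prime := ⟨hp⟩
  intro S hS
  obtain ⟨A, hA, hAne, hAs⟩ := exists_zero_sum_prime_pow (p := p) (a := a) rfl S.toEnumFinset
    (fun i (j : Fin r) => ((i.1 j : ℤ) : ZMod (p ^ a))) (by rwa [Multiset.card_toEnumFinset])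
  refine ⟨{A.1.map Prod.fst}, by simp, ?_, ?_⟩
  · simpa using Multiset.map_fst_le_of_subset_toEnumFinset hA
  · intro T hT
    rw [Multiset.mem_singleton] at hT
    subst hT
    constructor
    · simpa [Multiset.map_eq_zero] using hAne.ne_empty
    · refine exists_eq_smul_of_forall_cast_eq_zero fun j => ?_
      have h1 := congrFun hAs j
      rw [Finset.sum_apply] at h1
      have h2 : (A.1.map Prod.fst).sum = ∑ i ∈ A, i.1 := rfl
      rw [h2, Finset.sum_apply, Int.cast_sum]
      exact h1

/-! ### Bounds for the Davenport constant. -/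

theorem davenport_le_of_splitsInto {r n N : ℕ} [NeZero n] (hN : 1 ≤ N)
    (h : SplitsInto r n N 1) : davenport (Fin r → ZMod n) ≤ N := by
  classical
  refine (davenport_isLeast (Fin r → ZMod n)).2 ⟨hN, fun S hS => ?_⟩
  obtain ⟨l, hlc, hl, hlT⟩ := h (S.map fun v j => ((v j).val : ℤ)) (by simpa using hS)
  obtain ⟨T, rfl⟩ := Multiset.card_eq_one.1 hlc
  obtain ⟨hT0, y, hy⟩ := hlT T (by simp)
  rw [Multiset.sum_singleton] at hl
  obtain ⟨U, hU, rfl⟩ := Multiset.exists_le_map_eq_of_le_map hl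
  refine ⟨U, hU, by rintro rfl; exact hT0 rfl, ?_⟩
  let red : (Fin r → ℤ) →+ (Fin r → ZMod n) :=
    { toFun := fun v j => ((v j : ℤ) : ZMod n)
      map_zero' := by ext; simp
      map_add' := fun v w => by ext; simp }
  have h1 := congrArg red hy
  rw [map_multiset_sum, Multiset.map_map] at h1
  have h2 : U.map (red ∘ fun v j => ((v j).val : ℤ)) = U := by
    conv_rhs => rw [← Multiset.map_id U]
    refine Multiset.map_congr rfl fun v _ => ?_
    ext j
    simp [red]
  rw [h2] at h1
  rw [h1]
  ext j
  simp [red]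

/-- In a zero-sum subsequence of `n - 1` copies of each basis vector, coordinate `j` forces `n` to
divide the multiplicity of `e j`, which is less than `n`. -/
theorem davenport_ge (r n : ℕ) [NeZero n] :
    r * (n - 1) + 1 ≤ davenport (Fin r → ZMod n) := by
  classical
  rcases eq_or_ne n 1 with rfl | hn1
  · simpa using (davenport_isLeast (Fin r → ZMod 1)).1.1
  have hn : 1 < n := by have := NeZero.ne n; omega
  have : Fact (1 < n) := ⟨hn⟩
  by_contra! hlt
  let e : Fin r → Fin r → ZMod n := fun j => Pi.single j 1
  have he : Function.Injective e := fun i j h => by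
    by_contra hij
    have := congrFun h i
    simp [e, hij] at this
  let S : Multiset (Fin r → ZMod n) := ∑ j, Multiset.replicate (n - 1) (e j)
  have hcount : ∀ j, S.count (e j) = n - 1 := by
    intro j
    simp [S, Multiset.count_sum', Multiset.count_replicate, he.eq_iff]
  have hmem : ∀ v ∈ S, ∃ j, v = e j := by
    intro v hv
    obtain ⟨j, -, hj⟩ := Multiset.mem_sum.1 hv
    exact ⟨j, Multiset.eq_of_mem_replicate hj⟩
  have hcard : S.card = r * (n - 1) := by simp [S]
  obtain ⟨T, hTS, hT0, hTs⟩ := (davenport_isLeast (Fin r → ZMod n)).1.2 S (by omega)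
  obtain ⟨v, hv⟩ := Multiset.exists_mem_of_ne_zero hT0
  obtain ⟨j, rfl⟩ := hmem v (Multiset.mem_of_le hTS hv)
  have h1 : (T.map fun v => v j).sum = 0 := by
    have := congrArg (Pi.evalAddMonoidHom (fun _ : Fin r => ZMod n) j) hTs
    rw [map_multiset_sum, map_zero] at this
    exact this
  rw [Finset.sum_multiset_map_count, Finset.sum_eq_single_of_mem (e j) (by simpa using hv)] at h1
  · have h2 : ((T.count (e j) : ℕ) : ZMod n) = 0 := by simpa [e] using h1
    rw [ZMod.natCast_eq_zero_iff] at h2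
    have h3 : T.count (e j) ≤ n - 1 := hcount j ▸ Multiset.count_le_of_le _ hTS
    have h4 := Nat.le_of_dvd (Multiset.count_pos.2 hv) h2
    omega
  · intro w hw hne
    obtain ⟨i, rfl⟩ := hmem w (Multiset.mem_of_le hTS (by simpa using hw))
    have hij : j ≠ i := fun h => hne (by rw [h])
    simp [e, hij]

/-- A large integer has a large prime power divisor that dominates all its prime divisors. -/
theorem exists_large_prime_pow_dvd {Q n : ℕ} (hn : Q.factorial < n) :
    ∃ p a : ℕ, p.Prime ∧ p ^ a ∣ n ∧ Q < p ^ a ∧ ∀ l, l.Prime → l ∣ n → l ≤ p ^ a := by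
  classical
  have hn0 : 0 < n := by omega
  set D := n.divisors.filter fun d => ∃ p a : ℕ, p.Prime ∧ d = p ^ a with hD
  obtain ⟨d, hd, hQd⟩ : ∃ d ∈ D, Q < d := by
    by_contra! h
    -- If all prime power divisors of `n` were at most `Q`, each would divide `Q!`, hence so would
    -- `n`.
    have : n ∣ Q.factorial := by
      refine (Nat.dvd_iff_prime_pow_dvd_dvd _ _).2 fun p k hp hpk => ?_
      exact Nat.dvd_factorial (pow_pos hp.pos _)
        (h _ (by simp only [hD, Finset.mem_filter, Nat.mem_divisors]
                 exact ⟨⟨hpk, hn0.ne'⟩, p, k, hp, rfl⟩))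
    exact absurd (Nat.le_of_dvd (Nat.factorial_pos _) this) (by omega)
  obtain ⟨m, hm, hmax⟩ := Finset.exists_max_image D id ⟨d, hd⟩
  simp only [hD, Finset.mem_filter, Nat.mem_divisors, id] at hm hmax
  obtain ⟨⟨hmn, -⟩, p, a, hp, rfl⟩ := hm
  refine ⟨p, a, hp, hmn, ?_, fun l hl hln => ?_⟩
  · exact hQd.trans_le (hmax d (by simpa [hD] using hd))
  · exact hmax l ⟨⟨hln, hn0.ne'⟩, l, 1, hl, (pow_one l).symm⟩

theorem eventually_davenport_le (r : ℕ) (hr : 1 ≤ r) {δ : ℝ} (hδ : 0 < δ) :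
    ∀ᶠ n : ℕ in Filter.atTop, (davenport (Fin r → ZMod n) : ℝ) ≤ r * n + δ * n := by
  obtain ⟨K, hK⟩ := exists_splitsInto_prime r hr (ε := δ / 4) (by positivity)
  -- Collects the terms without a factor `q`: `2 * (|K| + 1)` from `2 * B`, with its rounding, and
  -- `1` from `r * q + 1`. The choice of `Q` makes `C ≤ δ / 2 * q`.
  set C : ℝ := 2 * |K| + 3 with hC
  have hCpos : 0 < C := by positivity
  obtain ⟨Q, hQ⟩ := exists_nat_ge (2 * C / δ)
  filter_upwards [Filter.eventually_gt_atTop Q.factorial] with n hn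
  obtain ⟨p, a, hp, ⟨m, rfl⟩, hQq, hmax⟩ := exists_large_prime_pow_dvd hn
  set q := p ^ a with hq
  have hqm : q * m ≠ 0 := by omega
  have : NeZero (q * m) := ⟨hqm⟩
  have hm : m ≠ 0 := right_ne_zero_of_mul hqm
  have hqpos : (0 : ℝ) < q := by exact_mod_cast Nat.pos_of_ne_zero (left_ne_zero_of_mul hqm)
  have hmpos : (0 : ℝ) < m := by exact_mod_cast Nat.pos_of_ne_zero hm
  set B := ⌈δ / 4 * q + |K|⌉₊ with hB
  have hB' : (B : ℝ) < δ / 4 * q + |K| + 1 := Nat.ceil_lt_add_one (by positivity)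
  -- The modulus `q` comes last, where a single subsequence is needed. Maximality of `q` lets one
  -- `B` serve all primes dividing `m`.
  have hsplit : SplitsInto r (m * q) (2 * B * (m - 1) + m * (r * q + 1)) 1 := by
    refine (SplitsInto.of_prime_factors m hm (fun l hl hlm => hK l B hl ?_) _).mul
      (splitsInto_prime_pow r p a hp)
    have : (l : ℝ) ≤ q := by exact_mod_cast hmax l hl (hlm.mul_left q)
    calc δ / 4 * l + K ≤ δ / 4 * q + |K| := by
          gcongr
          exact le_abs_self K
      _ ≤ B := Nat.le_ceil _
  rw [mul_comm m q] at hsplit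
  have hpos : 1 ≤ 2 * B * (m - 1) + m * (r * q + 1) := by
    have : 0 < m * (r * q + 1) := by positivity
    omega
  have hle := davenport_le_of_splitsInto hpos hsplit
  have hle' : davenport (Fin r → ZMod (q * m)) ≤ 2 * B * m + m * (r * q + 1) :=
    hle.trans (by gcongr; omega)
  have hle2 : (davenport (Fin r → ZMod (q * m)) : ℝ) ≤ 2 * B * m + m * (r * q + 1) := by
    exact_mod_cast hle'
  have hQq' : 2 * C / δ ≤ q := hQ.trans (by exact_mod_cast hQq.le)
  rw [div_le_iff₀ hδ] at hQq'
  calc (davenport (Fin r → ZMod (q * m)) : ℝ) ≤ 2 * B * m + m * (r * q + 1) := hle2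
    _ ≤ 2 * (δ / 4 * q + |K| + 1) * m + m * (r * q + 1) := by gcongr
    _ = r * (q * m) + m * (δ / 2 * q + C) := by rw [hC]; ring
    _ ≤ r * (q * m) + m * (δ / 2 * q + δ / 2 * q) := by
        gcongr
        linarith
    _ = _ := by push_cast; ring

theorem theorem1 (r : ℕ) (hr : 1 ≤ r) :
    Asymptotics.IsEquivalent Filter.atTop
      (fun n : ℕ => (davenport (Fin r → ZMod n) : ℝ)) (fun n : ℕ => (r : ℝ) * (n : ℝ)) := by
  have hr' : (1 : ℝ) ≤ r := by exact_mod_cast hr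
  refine Asymptotics.isLittleO_iff.2 fun δ hδ => ?_
  filter_upwards [eventually_davenport_le r hr hδ, Filter.eventually_ge_atTop 1,
    Filter.eventually_ge_atTop ⌈1 / δ⌉₊] with n hupper hn hnδ
  have : NeZero n := ⟨by omega⟩
  have hnδ' : 1 ≤ δ * n := by
    have := Nat.ceil_le.1 hnδ
    rwa [div_le_iff₀' hδ] at this
  have hlower : (r * ((n : ℝ) - 1) + 1 : ℝ) ≤ davenport (Fin r → ZMod n) := by
    have h := davenport_ge r n
    have h' : ((r * (n - 1) + 1 : ℕ) : ℝ) ≤ davenport (Fin r → ZMod n) := by exact_mod_cast h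
    rwa [Nat.cast_add, Nat.cast_mul, Nat.cast_sub hn, Nat.cast_one] at h'
  have hn0 : (0 : ℝ) ≤ n := Nat.cast_nonneg n
  rw [Pi.sub_apply, Real.norm_eq_abs, Real.norm_of_nonneg (by positivity), abs_le]
  constructor
  · have : (r : ℝ) * 1 ≤ r * (δ * n) := by gcongr
    linarith
  · have : 1 * (δ * n) ≤ r * (δ * n) := by gcongr
    linarith
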